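/- Let $\alpha>0$, let $d\lambda_\alpha(z)=\frac{\alpha}{\pi}e^{-\alpha|z|^2}\,dA(z)$ on $\mathbb C$, where $dA$ is the Euclidean area measure, and let $F^2_\alpha$ be the Fock space, i.e. the Hilbert space of all entire functions in $L^2(\mathbb C,d\lambda_\alpha)$, with $\langle f,g\rangle=\int_{\mathbb C} f\overline g\,d\lambda_\alpha$. For $w,z\in\mathbb C$ put $K_w(u)=e^{\alpha u\overline w}$, $k_z(u)=e^{-\frac\alpha2|z|^2+\alpha u\overline z}$, and $(U_zf)(u)=f(z-u)\,k_z(u)$ for $f\in F^2_\alpha$. Let $\mathcal D$ be the set of finite linear combinations of the functions $K_w$, $w\in\mathbb C$. Let $S$ be a linear operator on $F^2_\alpha$, not necessarily bounded or everywhere defined, such that the domains of $S$ and of its adjoint $S^*$ both contain $\mathcal D$ and such that $z\mapsto SK_z$ is conjugate analytic from $\mathbb C$ to $F^2_\alpha$. Put $S_z=U_zSU_z$ for $z\in\mathbb C$. Suppose that there are $p>2$ and $C>0$ such that $$\|S_z1\|_{L^p(\mathbb C,d\lambda_\alpha)}\le C\qquad\text{for all }z\in\mathbb C .$$ Then $S$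 is compact on $F^2_\alpha$ (that is, $S$ is the restriction to its domain of a compact operator defined on all of $F^2_\alpha$) if and only if its Berezin transform $\widetilde S(z)=\langle Sk_z,k_z\rangle$ tends to $0$ as $z\to\infty$. -/

import Mathlib

open MeasureTheory Filter Topology
open scoped ENNReal ComplexConjugate

noncomputable section

namespace Fock

/-- The Gaussian measure `(α / π) e^{-α |z|²} dA(z)` on the complex plane. -/
def gaussianMeasure (α : ℝ) : Measure ℂ :=
  volume.withDensity fun z => ENNReal.ofReal (α / Real.pi * Real.exp (-α * ‖z‖ ^ 2))

/-- The Fock space `F²_α`: the elements of `L²(ℂ, dλ_α)` that have an entire representative, with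
the norm and the inner product of `L²`. (Mathlib's `inner ℂ f g` is linear in `g`, so the inner
product `⟨f, g⟩ = ∫ f ḡ dλ_α` is `inner ℂ g f`.) -/
def space (α : ℝ) : Submodule ℂ (Lp ℂ 2 (gaussianMeasure α)) where
  carrier := {f | ∃ g : ℂ → ℂ, Differentiable ℂ g ∧ f =ᵐ[gaussianMeasure α] g}
  zero_mem' := ⟨0, differentiable_const 0, Lp.coeFn_zero _ _ _⟩
  add_mem' := by
    rintro a b ⟨g, hg, hag⟩ ⟨h, hh, hbh⟩
    exact ⟨g + h, hg.add hh, (Lp.coeFn_add a b).trans (hag.add hbh)⟩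
  smul_mem' := by
    rintro c a ⟨g, hg, hag⟩
    exact ⟨c • g, hg.const_smul c, (Lp.coeFn_smul c a).trans (hag.const_smul c)⟩

/-- The entire function that represents an element of the Fock space. -/
def toEntire {α : ℝ} (f : space α) : ℂ → ℂ := Classical.choose f.2

theorem differentiable_toEntire {α : ℝ} (f : space α) : Differentiable ℂ (toEntire f) :=
  (Classical.choose_spec f.2).1

theorem coe_ae_eq_toEntire {α : ℝ} (f : space α) :
    (f : Lp ℂ 2 (gaussianMeasure α)) =ᵐ[gaussianMeasure α] toEntire f :=
  (Classical.choose_spec f.2).2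

/-- An entire square integrable function as an element of the Fock space. -/
def ofEntire {α : ℝ} (g : ℂ → ℂ) (hg : Differentiable ℂ g)
    (hg2 : MemLp g 2 (gaussianMeasure α)) : space α :=
  ⟨hg2.toLp g, g, hg, hg2.coeFn_toLp⟩

theorem memLp_toEntire {α : ℝ} (f : space α) : MemLp (toEntire f) 2 (gaussianMeasure α) :=
  (memLp_congr_ae (coe_ae_eq_toEntire f)).1 (Lp.memLp _)

theorem ae_volume_of_ae {α : ℝ} (hα : 0 < α) {P : ℂ → Prop}
    (h : ∀ᵐ z ∂gaussianMeasure α, P z) : ∀ᵐ z ∂(volume : Measure ℂ), P z := by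
  rw [gaussianMeasure, ae_withDensity_iff (by fun_prop)] at h
  filter_upwards [h] with z hz
  apply hz
  have : 0 < α / Real.pi * Real.exp (-α * ‖z‖ ^ 2) := by positivity
  simpa using this

theorem eq_of_ae_eq {α : ℝ} (hα : 0 < α) {g h : ℂ → ℂ} (hg : Differentiable ℂ g)
    (hh : Differentiable ℂ h) (hgh : g =ᵐ[gaussianMeasure α] h) : g = h :=
  (Continuous.ae_eq_iff_eq volume hg.continuous hh.continuous).1 (ae_volume_of_ae hα hgh)

theorem toEntire_eq {α : ℝ} (hα : 0 < α) (f : space α) {g : ℂ → ℂ} (hg : Differentiable ℂ g)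
    (h : (f : Lp ℂ 2 (gaussianMeasure α)) =ᵐ[gaussianMeasure α] g) : toEntire f = g :=
  eq_of_ae_eq hα (differentiable_toEntire f) hg ((coe_ae_eq_toEntire f).symm.trans h)

theorem toEntire_ofEntire {α : ℝ} (hα : 0 < α) (g : ℂ → ℂ) (hg : Differentiable ℂ g)
    (hg2 : MemLp g 2 (gaussianMeasure α)) : toEntire (ofEntire g hg hg2) = g :=
  toEntire_eq hα _ hg hg2.coeFn_toLp

theorem toEntire_injective {α : ℝ} {f g : space α} (h : toEntire f = toEntire g) : f = g :=
  Subtype.ext (Lp.ext ((coe_ae_eq_toEntire f).trans (h ▸ (coe_ae_eq_toEntire g).symm)))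

theorem toEntire_add {α : ℝ} (hα : 0 < α) (f g : space α) :
    toEntire (f + g) = toEntire f + toEntire g :=
  toEntire_eq hα _ ((differentiable_toEntire f).add (differentiable_toEntire g))
    ((Lp.coeFn_add _ _).trans ((coe_ae_eq_toEntire f).add (coe_ae_eq_toEntire g)))

theorem toEntire_smul {α : ℝ} (hα : 0 < α) (c : ℂ) (f : space α) :
    toEntire (c • f) = c • toEntire f :=
  toEntire_eq hα _ ((differentiable_toEntire f).const_smul c)
    ((Lp.coeFn_smul _ _).trans ((coe_ae_eq_toEntire f).const_smul c))

/-- The reproducing kernel `K_w(z) = e^{α z w̄}` as a function of `z`. -/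
def kernelFun (α : ℝ) (w z : ℂ) : ℂ := Complex.exp (α * z * conj w)

/-- The normalized reproducing kernel `k_z(w) = e^{-(α/2)|z|² + α w z̄}` as a function of `w`. -/
def normalizedKernelFun (α : ℝ) (z w : ℂ) : ℂ :=
  Complex.exp (-(α / 2) * (‖z‖ : ℂ) ^ 2 + α * w * conj z)

theorem differentiable_kernelFun (α : ℝ) (w : ℂ) : Differentiable ℂ (kernelFun α w) := by
  unfold kernelFun; fun_prop

theorem differentiable_normalizedKernelFun (α : ℝ) (z : ℂ) :
    Differentiable ℂ (normalizedKernelFun α z) := by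
  unfold normalizedKernelFun; fun_prop

theorem memLp_iff {α : ℝ} (hα : 0 < α) {g : ℂ → ℂ} (hg : Continuous g) :
    MemLp g 2 (gaussianMeasure α) ↔
      Integrable (fun z => α / Real.pi * Real.exp (-α * ‖z‖ ^ 2) * ‖g z‖ ^ 2) := by
  rw [memLp_two_iff_integrable_sq_norm hg.aestronglyMeasurable, gaussianMeasure,
    integrable_withDensity_iff (by fun_prop) (by simp)]
  refine integrable_congr (Eventually.of_forall fun z => ?_)
  have : 0 ≤ α / Real.pi * Real.exp (-α * ‖z‖ ^ 2) := by positivity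
  simp only [ENNReal.toReal_ofReal this]
  ring

theorem weight_identity (α : ℝ) (z w : ℂ) :
    Real.exp (-α * ‖w‖ ^ 2) * ‖normalizedKernelFun α z w‖ ^ 2
      = Real.exp (-α * ‖z - w‖ ^ 2) := by
  rw [normalizedKernelFun, Complex.norm_exp, ← Real.exp_nat_mul, ← Real.exp_add]
  congr 1
  simp only [Complex.sq_norm, Complex.normSq_apply, ← Complex.ofReal_pow]
  simp
  ring

theorem memLp_translate {α : ℝ} (hα : 0 < α) (z : ℂ) {g : ℂ → ℂ} (hg : Differentiable ℂ g)
    (hg2 : MemLp g 2 (gaussianMeasure α)) :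
    MemLp (fun w => g (z - w) * normalizedKernelFun α z w) 2 (gaussianMeasure α) := by
  have hc : Continuous (fun w => g (z - w) * normalizedKernelFun α z w) :=
    (hg.continuous.comp (by fun_prop)).mul (differentiable_normalizedKernelFun α z).continuous
  rw [memLp_iff hα hc]
  refine (((memLp_iff hα hg.continuous).1 hg2).comp_sub_left z).congr
    (Eventually.of_forall fun w => ?_)
  simp only [norm_mul, mul_pow, ← weight_identity α z w]
  ring

theorem memLp_one {α : ℝ} (hα : 0 < α) :
    MemLp (fun _ : ℂ => (1 : ℂ)) 2 (gaussianMeasure α) := by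
  rw [memLp_iff hα continuous_const]
  have h := (GaussianFourier.integrable_cexp_neg_mul_sq_norm_add (V := ℂ) (b := (α : ℂ))
    (by simpa using hα) 0 0).norm
  refine (h.const_mul (α / Real.pi)).congr (Eventually.of_forall fun z => ?_)
  simp [Complex.norm_exp, ← Complex.ofReal_pow]

theorem memLp_normalizedKernelFun {α : ℝ} (hα : 0 < α) (z : ℂ) :
    MemLp (normalizedKernelFun α z) 2 (gaussianMeasure α) := by
  simpa using memLp_translate hα z (differentiable_const (1 : ℂ)) (memLp_one hα)

theorem kernelFun_eq (α : ℝ) (w : ℂ) :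
    kernelFun α w = Complex.exp (α / 2 * (‖w‖ : ℂ) ^ 2) • normalizedKernelFun α w := by
  ext z
  simp only [kernelFun, normalizedKernelFun, Pi.smul_apply, smul_eq_mul, ← Complex.exp_add]
  congr 1
  ring

theorem memLp_kernelFun {α : ℝ} (hα : 0 < α) (w : ℂ) :
    MemLp (kernelFun α w) 2 (gaussianMeasure α) := by
  rw [kernelFun_eq]
  exact (memLp_normalizedKernelFun hα w).const_smul _

/-- The reproducing kernel `K_w` as an element of the Fock space. -/
def kernel {α : ℝ} (hα : 0 < α) (w : ℂ) : space α :=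
  ofEntire (kernelFun α w) (differentiable_kernelFun α w) (memLp_kernelFun hα w)

/-- The normalized reproducing kernel `k_z` as an element of the Fock space. -/
def normalizedKernel {α : ℝ} (hα : 0 < α) (z : ℂ) : space α :=
  ofEntire (normalizedKernelFun α z) (differentiable_normalizedKernelFun α z)
    (memLp_normalizedKernelFun hα z)

/-- The constant function `1` as an element of the Fock space. -/
def one {α : ℝ} (hα : 0 < α) : space α :=
  ofEntire (fun _ => 1) (differentiable_const 1) (memLp_one hα)

/-- The space `𝒟` of finite linear combinations of reproducing kernels. -/
def kernelSpan {α : ℝ} (hα : 0 < α) : Submodule ℂ (space α) :=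
  Submodule.span ℂ (Set.range (kernel hα))

theorem kernel_mem {α : ℝ} (hα : 0 < α) (w : ℂ) : kernel hα w ∈ kernelSpan hα :=
  Submodule.subset_span ⟨w, rfl⟩

theorem normalizedKernel_mem {α : ℝ} (hα : 0 < α) (z : ℂ) :
    normalizedKernel hα z ∈ kernelSpan hα := by
  have h : normalizedKernel hα z
      = (Complex.exp (α / 2 * (‖z‖ : ℂ) ^ 2))⁻¹ • kernel hα z := by
    apply toEntire_injective
    rw [toEntire_smul hα, normalizedKernel, kernel, toEntire_ofEntire hα, toEntire_ofEntire hα,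
      kernelFun_eq, smul_smul, inv_mul_cancel₀ (Complex.exp_ne_zero _), one_smul]
  rw [h]
  exact Submodule.smul_mem _ _ (kernel_mem hα z)

/-- The operator `U_z f = (f ∘ φ_z) k_z` on the Fock space, where `φ_z(w) = z - w`. -/
def U {α : ℝ} (hα : 0 < α) (z : ℂ) : space α →ₗ[ℂ] space α where
  toFun f := ofEntire (fun w => toEntire f (z - w) * normalizedKernelFun α z w)
    (((differentiable_toEntire f).comp (by fun_prop)).mul (differentiable_normalizedKernelFun α z))
    (memLp_translate hα z (differentiable_toEntire f) (memLp_toEntire f))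
  map_add' f g := by
    apply toEntire_injective
    rw [toEntire_ofEntire hα, toEntire_add hα, toEntire_add hα, toEntire_ofEntire hα,
      toEntire_ofEntire hα]
    ext w
    simp [add_mul]
  map_smul' c f := by
    apply toEntire_injective
    rw [RingHom.id_apply, toEntire_ofEntire hα, toEntire_smul hα, toEntire_smul hα,
      toEntire_ofEntire hα]
    ext w
    simp [mul_assoc]

theorem U_one {α : ℝ} (hα : 0 < α) (z : ℂ) : U hα z (one hα) = normalizedKernel hα z := by
  apply toEntire_injective
  simp only [U, one, normalizedKernel, LinearMap.coe_mk, AddHom.coe_mk, toEntire_ofEntire hα,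
    one_mul]

/-- The operator `S_z = U_z S U_z`, with its natural domain `{f | U_z f ∈ dom S}`. -/
def conjugate {α : ℝ} (hα : 0 < α) (S : space α →ₗ.[ℂ] space α) (z : ℂ) :
    space α →ₗ.[ℂ] space α where
  domain := S.domain.comap (U hα z)
  toFun := (U hα z).comp (S.toFun.comp
    (((U hα z).domRestrict (S.domain.comap (U hα z))).codRestrict S.domain fun x => x.2))

theorem one_mem_domain {α : ℝ} (hα : 0 < α) {S : space α →ₗ.[ℂ] space α}
    (hS : kernelSpan hα ≤ S.domain) (z : ℂ) : one hα ∈ (conjugate hα S z).domain := by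
  change U hα z (one hα) ∈ S.domain
  rw [U_one]
  exact hS (normalizedKernel_mem hα z)

/-- The Berezin transform `z ↦ ⟨S k_z, k_z⟩` of an operator whose domain contains `𝒟`. -/
def berezin {α : ℝ} (hα : 0 < α) (S : space α →ₗ.[ℂ] space α)
    (hS : kernelSpan hα ≤ S.domain) (z : ℂ) : ℂ :=
  inner ℂ (normalizedKernel hα z) (S ⟨normalizedKernel hα z, hS (normalizedKernel_mem hα z)⟩)

/-- A densely defined operator is compact on the Fock space if it is the restriction to its domain
of a compact operator that is defined everywhere. -/
def IsCompactOn {α : ℝ} (S : space α →ₗ.[ℂ] space α) : Prop :=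
  ∃ T : space α →L[ℂ] space α, IsCompactOperator T ∧ ∀ f : S.domain, T f = S f

end Fock

end

noncomputable section

/-! ### The Gaussian measure, the reproducing property and the resolution of the identity. -/

namespace Fock

/-! The argument is carried by the matrix `⟨S k_z, k_w⟩` of `S` in the normalized kernels, which
form a continuous resolution of the identity: `f = (α/π) ∫ ⟨f, k_z⟩ k_z dA(z)` weakly.

Up to a unimodular factor, `⟨S k_z, k_w⟩` is `⟨S_z 1, k_{z-w}⟩`, so Hölder's inequality and the
bound on `S_z 1` in `L^p` give `|⟨S k_z, k_w⟩| ≤ C exp(-δ|z-w|²)` with `δ = α/2 - αq/4`, where `q`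
is conjugate to `p`. Here `δ > 0` because `p > 2` means `q < 2`
(`norm_inner_normalizedKernel_apply_le`). Schur's test then makes `S` bounded
(`exists_norm_apply_le`), and it extends to a bounded operator `T`.

If the Berezin transform vanishes at infinity, then so does `⟨T k_z, k_{z-u}⟩` for every fixed `u`:
a weak limit of the translates `U_z* T U_z` has zero Berezin transform, and an operator with zero
Berezin transform is zero (`tendsto_inner_normalizedKernel_sub`). Under the Gaussian majorant,
dominated convergence gives `∫ |⟨T k_z, k_w⟩| dA(w) → 0` as `z → ∞`. By Schur's test the compact
truncations of `T` to `|z| ≤ R` converge to `T` in norm (`isCompactOperator_of_tendsto`).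

The converse holds because `k_z → 0` weakly as `z → ∞`. -/

theorem integral_gaussianMeasure {E : Type*} [NormedAddCommGroup E] [NormedSpace ℝ E] {α : ℝ}
    (hα : 0 < α) (g : ℂ → E) :
    ∫ z, g z ∂gaussianMeasure α
      = ∫ z, (α / Real.pi * Real.exp (-α * ‖z‖ ^ 2)) • g z := by
  rw [gaussianMeasure, integral_withDensity_eq_integral_toReal_smul (by fun_prop) (by simp)]
  refine integral_congr_ae (Eventually.of_forall fun z => ?_)
  have : 0 ≤ α / Real.pi * Real.exp (-α * ‖z‖ ^ 2) := by positivity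
  simp only [ENNReal.toReal_ofReal this]

theorem integrable_exp_neg_mul_sq_norm {b : ℝ} (hb : 0 < b) :
    Integrable fun z : ℂ => Real.exp (-b * ‖z‖ ^ 2) := by
  have h := (GaussianFourier.integrable_cexp_neg_mul_sq_norm_add (V := ℂ) (b := (b : ℂ))
    (by simpa using hb) 0 0).norm
  refine h.congr (Eventually.of_forall fun z => ?_)
  simp [Complex.norm_exp, ← Complex.ofReal_pow]

theorem integral_exp_neg_mul_sq_norm {b : ℝ} (hb : 0 < b) :
    ∫ z : ℂ, Real.exp (-b * ‖z‖ ^ 2) = Real.pi / b := by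
  rw [GaussianFourier.integral_rexp_neg_mul_sq_norm hb]
  simp

theorem isProbabilityMeasure_gaussianMeasure {α : ℝ} (hα : 0 < α) :
    IsProbabilityMeasure (gaussianMeasure α) := by
  constructor
  rw [gaussianMeasure, withDensity_apply _ MeasurableSet.univ, setLIntegral_univ,
    ← ofReal_integral_eq_lintegral_ofReal]
  · rw [integral_const_mul, integral_exp_neg_mul_sq_norm hα]
    have := Real.pi_pos.ne'
    have := hα.ne'
    field_simp
    simp
  · exact (integrable_exp_neg_mul_sq_norm hα).const_mul _
  · exact Eventually.of_forall fun z => by positivity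

theorem measurePreserving_mul_gaussianMeasure (α : ℝ) {c : ℂ} (hc : ‖c‖ = 1) :
    MeasurePreserving (fun z => c * z) (gaussianMeasure α) (gaussianMeasure α) := by
  have hv : MeasurePreserving (fun z : ℂ => c * z) := by
    have := (rotation (⟨c, by simp [Submonoid.unitSphere, hc]⟩ : Circle)).measurePreserving
    exact this
  refine ⟨by fun_prop, ?_⟩
  ext s hs
  rw [Measure.map_apply (by fun_prop) hs, gaussianMeasure, withDensity_apply _ hs,
    withDensity_apply _ (hs.preimage (by fun_prop)),
    ← hv.setLIntegral_comp_preimage hs (by fun_prop)]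
  simp [hc]

/-- The measure is a rotation invariant probability measure, so `f` may be averaged over rotations
under the integral; the mean value property turns that average into `f 0`. -/
theorem integral_entire {α : ℝ} (hα : 0 < α) {f : ℂ → ℂ} (hf : Differentiable ℂ f)
    (hfi : Integrable f (gaussianMeasure α)) : ∫ z, f z ∂gaussianMeasure α = f 0 := by
  have := isProbabilityMeasure_gaussianMeasure hα
  have hmp (θ : ℝ) : MeasurePreserving (fun z => circleMap 0 1 θ * z)
      (gaussianMeasure α) (gaussianMeasure α) :=
    measurePreserving_mul_gaussianMeasure α (by simp)
  have hemb (θ : ℝ) : MeasurableEmbedding (fun z => circleMap 0 1 θ * z) :=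
    measurableEmbedding_mulLeft₀ (by simp)
  have h1 (θ : ℝ) : ∫ z, f (circleMap 0 1 θ * z) ∂gaussianMeasure α
      = ∫ z, f z ∂gaussianMeasure α := (hmp θ).integral_comp (hemb θ) f
  have h2 (z : ℂ) : ∫ θ in Set.Ioc 0 (2 * Real.pi), f (circleMap 0 1 θ * z)
      = (2 * Real.pi : ℝ) • f 0 := by
    have hd : Differentiable ℂ fun t => f (t * z) := hf.comp (by fun_prop)
    have h := DiffContOnCl.circleAverage (c := 0) (R := 1)
      (f := fun t => f (t * z)) hd.diffContOnCl
    rw [Real.circleAverage_def, intervalIntegral.integral_of_le Real.two_pi_pos.le] at h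
    rw [inv_smul_eq_iff₀ (by positivity)] at h
    rw [h]
    simp
  have hint : Integrable (Function.uncurry fun (θ : ℝ) z => f (circleMap 0 1 θ * z))
      ((volume.restrict (Set.Ioc 0 (2 * Real.pi))).prod (gaussianMeasure α)) := by
    have hc : Continuous (Function.uncurry fun (θ : ℝ) z => f (circleMap 0 1 θ * z)) := by
      refine hf.continuous.comp ?_
      have := continuous_circleMap 0 1
      fun_prop
    rw [integrable_prod_iff hc.aestronglyMeasurable]
    refine ⟨Eventually.of_forall fun θ => (hmp θ).integrable_comp_of_integrable hfi, ?_⟩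
    refine (integrable_const (∫ z, ‖f z‖ ∂gaussianMeasure α)).congr
      (Eventually.of_forall fun θ => ?_)
    exact ((hmp θ).integral_comp (hemb θ) fun z => ‖f z‖).symm
  have h3 := integral_integral_swap hint
  simp only [h1, h2] at h3
  simp only [integral_const, probReal_univ, one_smul, MeasurableSet.univ, measureReal_restrict_apply,
    Set.univ_inter, Real.volume_real_Ioc_of_le Real.two_pi_pos.le, sub_zero] at h3
  exact smul_right_injective ℂ Real.two_pi_pos.ne' h3

theorem inner_eq_integral {α : ℝ} (f g : space α) :
    inner ℂ f g = ∫ z, conj (toEntire f z) * toEntire g z ∂gaussianMeasure α := by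
  rw [Submodule.coe_inner, L2.inner_def]
  refine integral_congr_ae ?_
  filter_upwards [coe_ae_eq_toEntire f, coe_ae_eq_toEntire g] with z h1 h2
  rw [h1, h2, RCLike.inner_apply, mul_comm]

/-- This is `integral_entire` for `U_u g`, whose value at `0` is `g(u) exp(-(α/2)|u|²)`, after the
substitution `w ↦ u - w`. It is stated for functions because `inner_kernel` and the Hölder estimate
both start from the integral. -/
theorem integral_conj_kernelFun_mul {α : ℝ} (hα : 0 < α) (u : ℂ) {g : ℂ → ℂ}
    (hg : Differentiable ℂ g) (hg2 : MemLp g 2 (gaussianMeasure α)) :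
    ∫ z, conj (kernelFun α u z) * g z ∂gaussianMeasure α = g u := by
  have := isProbabilityMeasure_gaussianMeasure hα
  have h := integral_entire hα (f := fun w => g (u - w) * normalizedKernelFun α u w)
    ((hg.comp (by fun_prop)).mul (differentiable_normalizedKernelFun α u))
    ((memLp_translate hα u hg hg2).integrable one_le_two)
  rw [integral_gaussianMeasure hα, ← integral_sub_left_eq_self _ _ u] at h
  rw [integral_gaussianMeasure hα]
  have hne : Complex.exp (-(α / 2) * (‖u‖ : ℂ) ^ 2) ≠ 0 := Complex.exp_ne_zero _
  refine mul_left_cancel₀ hne ?_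
  rw [← integral_const_mul]
  convert h using 1
  · refine integral_congr_ae (Eventually.of_forall fun v => ?_)
    have key : Complex.exp (-(α / 2) * (‖u‖ : ℂ) ^ 2)
        * (Complex.exp (-α * (‖v‖ : ℂ) ^ 2) * Complex.exp (conj (α * v * conj u)))
        = Complex.exp (-α * (‖u - v‖ : ℂ) ^ 2)
          * Complex.exp (-(α / 2) * (‖u‖ : ℂ) ^ 2 + α * (u - v) * conj u) := by
      simp only [← Complex.exp_add]
      congr 1
      simp only [map_mul, Complex.conj_ofReal, Complex.conj_conj, ← Complex.conj_mul', map_sub]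
      ring
    simp only [sub_sub_cancel, normalizedKernelFun, kernelFun, Complex.real_smul,
      ← Complex.exp_conj]
    push_cast
    linear_combination (α / Real.pi * g v) * key
  · simp [normalizedKernelFun, mul_comm]

theorem inner_kernel {α : ℝ} (hα : 0 < α) (u : ℂ) (f : space α) :
    inner ℂ (kernel hα u) f = toEntire f u := by
  rw [inner_eq_integral, kernel, toEntire_ofEntire hα]
  exact integral_conj_kernelFun_mul hα u (differentiable_toEntire f) (memLp_toEntire f)

theorem toEntire_kernel {α : ℝ} (hα : 0 < α) (u : ℂ) : toEntire (kernel hα u) = kernelFun α u :=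
  toEntire_ofEntire hα _ _ _

theorem toEntire_normalizedKernel {α : ℝ} (hα : 0 < α) (u : ℂ) :
    toEntire (normalizedKernel hα u) = normalizedKernelFun α u :=
  toEntire_ofEntire hα _ _ _

theorem inner_kernel_kernel {α : ℝ} (hα : 0 < α) (u v : ℂ) :
    inner ℂ (kernel hα u) (kernel hα v) = Complex.exp (α * u * conj v) := by
  rw [inner_kernel, toEntire_kernel, kernelFun]

theorem norm_kernel_sq {α : ℝ} (hα : 0 < α) (u : ℂ) :
    ‖kernel hα u‖ ^ 2 = Real.exp (α * ‖u‖ ^ 2) := by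
  have h := inner_self_eq_norm_sq_to_K (𝕜 := ℂ) (kernel hα u)
  rw [inner_kernel_kernel, mul_assoc, Complex.mul_conj'] at h
  simp only [Complex.coe_algebraMap] at h
  exact_mod_cast h.symm

theorem normalizedKernel_eq {α : ℝ} (hα : 0 < α) (z : ℂ) :
    normalizedKernel hα z = (Real.exp (-(α / 2) * ‖z‖ ^ 2) : ℂ) • kernel hα z := by
  apply toEntire_injective
  rw [toEntire_smul hα, toEntire_kernel, toEntire_normalizedKernel]
  ext w
  simp only [normalizedKernelFun, kernelFun, Pi.smul_apply, smul_eq_mul, Complex.ofReal_exp,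
    ← Complex.exp_add]
  push_cast
  rfl

theorem kernel_eq {α : ℝ} (hα : 0 < α) (z : ℂ) :
    kernel hα z = (Real.exp (α / 2 * ‖z‖ ^ 2) : ℂ) • normalizedKernel hα z := by
  rw [normalizedKernel_eq, smul_smul, ← Complex.ofReal_mul, ← Real.exp_add]
  simp

theorem norm_normalizedKernel {α : ℝ} (hα : 0 < α) (z : ℂ) : ‖normalizedKernel hα z‖ = 1 := by
  have h : ‖normalizedKernel hα z‖ ^ 2 = 1 := by
    rw [normalizedKernel_eq, norm_smul, mul_pow, norm_kernel_sq, Complex.norm_real,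
      Real.norm_of_nonneg (Real.exp_pos _).le, ← Real.exp_nat_mul, ← Real.exp_add]
    rw [Real.exp_eq_one_iff]
    push_cast
    ring
  exact (sq_eq_sq₀ (norm_nonneg _) zero_le_one).1 (by simpa using h)

theorem inner_normalizedKernel {α : ℝ} (hα : 0 < α) (u : ℂ) (f : space α) :
    inner ℂ (normalizedKernel hα u) f = Real.exp (-(α / 2) * ‖u‖ ^ 2) * toEntire f u := by
  rw [normalizedKernel_eq, inner_smul_left (E := space α), inner_kernel, Complex.conj_ofReal]

theorem continuous_kernel {α : ℝ} (hα : 0 < α) : Continuous (kernel hα) := by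
  rw [continuous_iff_continuousAt]
  intro z
  rw [ContinuousAt, tendsto_iff_norm_sub_tendsto_zero]
  have h (w : ℂ) : ‖kernel hα w - kernel hα z‖ = √(Real.exp (α * ‖w‖ ^ 2)
      - 2 * (Complex.exp (α * w * conj z)).re + Real.exp (α * ‖z‖ ^ 2)) := by
    rw [← norm_kernel_sq hα, ← norm_kernel_sq hα, ← inner_kernel_kernel hα,
      ← RCLike.re_eq_complex_re, ← norm_sub_sq, Real.sqrt_sq (norm_nonneg _)]
  simp only [h]
  have hc : Continuous fun w => √(Real.exp (α * ‖w‖ ^ 2)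
      - 2 * (Complex.exp (α * w * conj z)).re + Real.exp (α * ‖z‖ ^ 2)) := by fun_prop
  convert hc.tendsto z
  rw [← h, sub_self, norm_zero]

theorem continuous_normalizedKernel {α : ℝ} (hα : 0 < α) : Continuous (normalizedKernel hα) := by
  simp only [funext (normalizedKernel_eq hα)]
  have h : Continuous fun z : ℂ => (Real.exp (-(α / 2) * ‖z‖ ^ 2) : ℂ) := by fun_prop
  exact h.smul (continuous_kernel hα)

/-- Since `‖K_u‖` is locally bounded, convergence in norm forces locally uniform convergence of the
entire representatives to `u ↦ ⟨f, K_u⟩`, which is therefore entire; an almost everywhere convergent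
subsequence identifies it with `f`. -/
theorem isClosed_space {α : ℝ} (hα : 0 < α) :
    IsClosed (space α : Set (Lp ℂ 2 (gaussianMeasure α))) := by
  refine isClosed_of_closure_subset fun f hf => ?_
  obtain ⟨F, hF, hlim⟩ := mem_closure_iff_seq_limit.1 hf
  lift F to ℕ → space α using hF
  let k (u : ℂ) : Lp ℂ 2 (gaussianMeasure α) := kernel hα u
  have hk : Continuous k := continuous_subtype_val.comp (continuous_kernel hα)
  have hval (n : ℕ) (u : ℂ) : toEntire (F n) u = inner ℂ (k u) (F n : Lp ℂ 2 _) :=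
    (inner_kernel hα u (F n)).symm
  have hunif : TendstoLocallyUniformly (fun n => toEntire (F n)) (fun u => inner ℂ (k u) f)
      atTop := by
    rw [tendstoLocallyUniformly_iff_forall_isCompact]
    intro K hK
    obtain ⟨M, hM⟩ := hK.exists_bound_of_continuousOn hk.continuousOn
    rw [Metric.tendstoUniformlyOn_iff]
    intro ε hε
    have hlim' := (tendsto_iff_norm_sub_tendsto_zero.1 hlim).const_mul M
    rw [mul_zero] at hlim'
    filter_upwards [hlim'.eventually_lt_const hε] with n hn u hu
    rw [dist_comm, dist_eq_norm, hval, ← inner_sub_right]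
    refine (norm_inner_le_norm _ _).trans_lt (lt_of_le_of_lt ?_ hn)
    gcongr
    exact hM u hu
  have hdiff : Differentiable ℂ fun u => inner ℂ (k u) f :=
    differentiableOn_univ.1 <| (tendstoLocallyUniformlyOn_univ.2 hunif).differentiableOn
      (Eventually.of_forall fun n => (differentiable_toEntire (F n)).differentiableOn) isOpen_univ
  refine ⟨_, hdiff, ?_⟩
  obtain ⟨ns, hsub, hns⟩ := (tendstoInMeasure_of_tendsto_Lp hlim).exists_seq_tendsto_ae
  have hall : ∀ᵐ z ∂gaussianMeasure α, ∀ n,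
      ((F n : Lp ℂ 2 (gaussianMeasure α)) : ℂ → ℂ) z = toEntire (F n) z :=
    ae_all_iff.2 fun n => coe_ae_eq_toEntire (F n)
  filter_upwards [hns, hall] with z hz hz'
  simp only [hz'] at hz
  exact tendsto_nhds_unique hz
    (((tendstoLocallyUniformlyOn_univ.2 hunif).tendsto_at (Set.mem_univ z)).comp hsub.tendsto_atTop)

theorem completeSpace {α : ℝ} (hα : 0 < α) : CompleteSpace (space α) :=
  (isClosed_space hα).completeSpace_coe

/-- The weight `exp(-α|z|²)` splits into two equal factors, each of which normalizes one kernel. -/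
theorem inner_eq_integral_normalizedKernel {α : ℝ} (hα : 0 < α) (f g : space α) :
    inner ℂ f g = ∫ z, ((α / Real.pi : ℝ) : ℂ)
      * (inner ℂ f (normalizedKernel hα z) * inner ℂ (normalizedKernel hα z) g) := by
  rw [inner_eq_integral, integral_gaussianMeasure hα]
  refine integral_congr_ae (Eventually.of_forall fun z => ?_)
  simp only [inner_normalizedKernel]
  rw [← inner_conj_symm (E := space α), inner_normalizedKernel, map_mul, Complex.conj_ofReal, Complex.real_smul]
  have : Real.exp (-α * ‖z‖ ^ 2)
      = Real.exp (-(α / 2) * ‖z‖ ^ 2) * Real.exp (-(α / 2) * ‖z‖ ^ 2) := by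
    rw [← Real.exp_add]
    ring_nf
  rw [this]
  push_cast
  ring

/-- The diagonal case in `ℝ≥0∞`, a form in which Schur's test and changes of variable need no
integrability. -/
theorem lintegral_enorm_inner_normalizedKernel {α : ℝ} (hα : 0 < α) (f : space α) :
    ENNReal.ofReal (α / Real.pi) * ∫⁻ z, ‖inner ℂ (normalizedKernel hα z) f‖ₑ ^ 2 = ‖f‖ₑ ^ 2 := by
  have hi : Integrable fun z => α / Real.pi * Real.exp (-α * ‖z‖ ^ 2) * ‖toEntire f z‖ ^ 2 :=
    (memLp_iff hα (differentiable_toEntire f).continuous).1 (memLp_toEntire f)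
  have h0 (z : ℂ) : α / Real.pi * Real.exp (-α * ‖z‖ ^ 2) * ‖toEntire f z‖ ^ 2
      = α / Real.pi * ‖(inner ℂ (normalizedKernel hα z) f : ℂ)‖ ^ 2 := by
    rw [inner_normalizedKernel, norm_mul, mul_pow, Complex.norm_real,
      Real.norm_of_nonneg (Real.exp_pos _).le, ← Real.exp_nat_mul, mul_assoc]
    rw [show (2 : ℕ) * (-(α / 2) * ‖z‖ ^ 2) = -α * ‖z‖ ^ 2 by push_cast; ring]
  have hn : ‖f‖ ^ 2 = ∫ z, α / Real.pi * ‖(inner ℂ (normalizedKernel hα z) f : ℂ)‖ ^ 2 := by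
    have h := inner_self_eq_norm_sq_to_K (𝕜 := ℂ) f
    rw [inner_eq_integral_normalizedKernel hα] at h
    apply Complex.ofReal_injective
    rw [← integral_complex_ofReal]
    push_cast
    refine h.symm.trans ?_
    refine integral_congr_ae (Eventually.of_forall fun z => ?_)
    beta_reduce
    rw [← inner_conj_symm (E := space α) f, Complex.conj_mul']
    push_cast
    rfl
  simp only [h0] at hi
  rw [← lintegral_const_mul' _ _ ENNReal.ofReal_ne_top, ← ofReal_norm f,
    ← ENNReal.ofReal_pow (norm_nonneg _), hn,
    ofReal_integral_eq_lintegral_ofReal hi (Eventually.of_forall fun z => by positivity)]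
  refine lintegral_congr fun z => ?_
  rw [ENNReal.ofReal_mul (by positivity), ← ofReal_norm, ENNReal.ofReal_pow (norm_nonneg _)]

theorem toEntire_U {α : ℝ} (hα : 0 < α) (z : ℂ) (f : space α) (w : ℂ) :
    toEntire (U hα z f) w = toEntire f (z - w) * normalizedKernelFun α z w := by
  simp only [U, LinearMap.coe_mk, AddHom.coe_mk, toEntire_ofEntire hα]

theorem norm_inner_normalizedKernel_U {α : ℝ} (hα : 0 < α) (z u : ℂ) (f : space α) :
    ‖(inner ℂ (normalizedKernel hα u) (U hα z f) : ℂ)‖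
      = ‖(inner ℂ (normalizedKernel hα (z - u)) f : ℂ)‖ := by
  rw [inner_normalizedKernel, inner_normalizedKernel, toEntire_U, norm_mul, norm_mul, norm_mul,
    normalizedKernelFun, Complex.norm_exp, Complex.norm_real, Complex.norm_real,
    Real.norm_of_nonneg (Real.exp_pos _).le, Real.norm_of_nonneg (Real.exp_pos _).le,
    mul_left_comm, ← Real.exp_add, mul_comm]
  congr 2
  simp only [Complex.sq_norm, Complex.normSq_apply, ← Complex.ofReal_pow]
  simp
  ring

/-- `U_z` moves the modulus of the coefficient function `u ↦ ⟨f, k_u⟩` by the measure preserving map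
`u ↦ z - u`. -/
theorem norm_U {α : ℝ} (hα : 0 < α) (z : ℂ) (f : space α) : ‖U hα z f‖ = ‖f‖ := by
  have h : ‖U hα z f‖ₑ ^ 2 = ‖f‖ₑ ^ 2 := by
    rw [← lintegral_enorm_inner_normalizedKernel hα, ← lintegral_enorm_inner_normalizedKernel hα,
      ← lintegral_sub_left_eq_self (fun w => ‖inner ℂ (normalizedKernel hα w) f‖ₑ ^ 2) z]
    congr 1
    refine lintegral_congr fun u => ?_
    rw [← ofReal_norm, norm_inner_normalizedKernel_U, ofReal_norm]
  have h' := (ENNReal.pow_right_strictMono two_ne_zero).injective h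
  rw [← toReal_enorm, h', toReal_enorm]

theorem U_kernel {α : ℝ} (hα : 0 < α) (z u : ℂ) :
    U hα z (kernel hα u)
      = Complex.exp (α * z * conj u - α / 2 * (‖z‖ : ℂ) ^ 2) • kernel hα (z - u) := by
  apply toEntire_injective
  ext w
  rw [toEntire_U, toEntire_smul hα, toEntire_kernel, toEntire_kernel, Pi.smul_apply, smul_eq_mul,
    kernelFun, kernelFun, normalizedKernelFun, ← Complex.exp_add, ← Complex.exp_add, map_sub]
  congr 1
  ring

theorem U_normalizedKernel {α : ℝ} (hα : 0 < α) (z u : ℂ) :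
    ∃ c : ℂ, ‖c‖ = 1 ∧ U hα z (normalizedKernel hα u) = c • normalizedKernel hα (z - u) := by
  have h : ∃ c : ℂ, U hα z (normalizedKernel hα u) = c • normalizedKernel hα (z - u) := by
    rw [normalizedKernel_eq, map_smul, U_kernel, kernel_eq hα (z - u), smul_smul, smul_smul]
    exact ⟨_, rfl⟩
  obtain ⟨c, hc⟩ := h
  refine ⟨c, ?_, hc⟩
  have := norm_U hα z (normalizedKernel hα u)
  rwa [hc, norm_smul, norm_normalizedKernel, norm_normalizedKernel, mul_one] at this

theorem dense_kernelSpan {α : ℝ} (hα : 0 < α) : Dense (kernelSpan hα : Set (space α)) := by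
  have := completeSpace hα
  rw [Submodule.dense_iff_topologicalClosure_eq_top, Submodule.topologicalClosure_eq_top_iff,
    Submodule.eq_bot_iff]
  intro f hf
  apply toEntire_injective
  ext w
  rw [← inner_kernel hα, ← inner_kernel hα, inner_zero_right]
  exact (Submodule.mem_orthogonal _ _).1 hf _ (kernel_mem hα w)

end Fock

/-- Schur's test. -/
theorem lintegral_sq_lintegral_mul_le {X Y : Type*} [MeasurableSpace X] [MeasurableSpace Y]
    {μ : Measure X} {ν : Measure Y} [SFinite μ] [SFinite ν] {G : X → Y → ℝ≥0∞}
    (hG : Measurable (Function.uncurry G)) {φ : X → ℝ≥0∞} (hφ : Measurable φ) {a b : ℝ≥0∞}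
    (ha : ∀ x, ∫⁻ y, G x y ∂ν ≤ a) (hb : ∀ y, ∫⁻ x, G x y ∂μ ≤ b) :
    ∫⁻ y, (∫⁻ x, φ x * G x y ∂μ) ^ 2 ∂ν ≤ a * b * ∫⁻ x, φ x ^ 2 ∂μ := by
  have hGy (y : Y) : Measurable fun x => G x y := hG.comp (measurable_id.prodMk measurable_const)
  have hGx (x : X) : Measurable (G x) := hG.comp (measurable_const.prodMk measurable_id)
  -- Cauchy–Schwarz for the splitting `φ G = (φ G^(1/2)) · G^(1/2)`; the second factor is absorbed
  -- by `b`.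
  have hCS (y : Y) : (∫⁻ x, φ x * G x y ∂μ) ^ 2 ≤ b * ∫⁻ x, φ x ^ 2 * G x y ∂μ := by
    have h := ENNReal.lintegral_mul_norm_pow_le (μ := μ) (f := fun x => φ x ^ 2 * G x y)
      (g := fun x => G x y) ((hφ.pow_const 2).mul (hGy y)).aemeasurable (hGy y).aemeasurable
      (p := 1 / 2) (q := 1 / 2) (by norm_num) (by norm_num) (by norm_num)
    have hpt (s t : ℝ≥0∞) : (s ^ 2 * t) ^ (1 / 2 : ℝ) * t ^ (1 / 2 : ℝ) = s * t := by
      rw [← ENNReal.mul_rpow_of_nonneg _ _ (by norm_num), show s ^ 2 * t * t = (s * t) ^ 2 by ring,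
        ← ENNReal.rpow_natCast, ← ENNReal.rpow_mul]
      norm_num
    have hsq (s : ℝ≥0∞) : (s ^ (1 / 2 : ℝ)) ^ 2 = s := by
      rw [← ENNReal.rpow_natCast, ← ENNReal.rpow_mul]
      norm_num
    simp only [hpt] at h
    calc (∫⁻ x, φ x * G x y ∂μ) ^ 2
        ≤ ((∫⁻ x, φ x ^ 2 * G x y ∂μ) ^ (1 / 2 : ℝ) * (∫⁻ x, G x y ∂μ) ^ (1 / 2 : ℝ)) ^ 2 := by
          gcongr
      _ = (∫⁻ x, G x y ∂μ) * ∫⁻ x, φ x ^ 2 * G x y ∂μ := by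
          rw [mul_pow, hsq, hsq, mul_comm]
      _ ≤ _ := by gcongr; exact hb y
  have hm : Measurable (Function.uncurry fun y x => φ x ^ 2 * G x y) :=
    ((hφ.comp measurable_snd).pow_const 2).mul (hG.comp measurable_swap)
  calc ∫⁻ y, (∫⁻ x, φ x * G x y ∂μ) ^ 2 ∂ν
      ≤ ∫⁻ y, b * ∫⁻ x, φ x ^ 2 * G x y ∂μ ∂ν := lintegral_mono hCS
    _ = b * ∫⁻ x, ∫⁻ y, φ x ^ 2 * G x y ∂ν ∂μ := by
        rw [lintegral_const_mul _ hm.lintegral_prod_right, lintegral_lintegral_swap hm.aemeasurable]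
    _ ≤ b * ∫⁻ x, φ x ^ 2 * a ∂μ := by
        gcongr with x
        rw [lintegral_const_mul _ (hGx x)]
        gcongr
        exact ha x
    _ = a * b * ∫⁻ x, φ x ^ 2 ∂μ := by
        rw [lintegral_mul_const _ (hφ.pow_const 2)]
        ring

/-! ### Compactness from the decay of matrix coefficients. -/

section CoherentStates

variable {E : Type*} [NormedAddCommGroup E] [InnerProductSpace ℂ E]

/-- A continuous family of unit vectors `k` such that `f = c ∫ ⟨k z, f⟩ k z dz` weakly. -/
structure IsCoherentFamily (c : ℝ) (k : ℂ → E) : Prop where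
  pos : 0 < c
  continuous : Continuous k
  norm_eq : ∀ z, ‖k z‖ = 1
  inner_eq : ∀ f g : E, inner ℂ f g = ∫ z, (c : ℂ) * (inner ℂ f (k z) * inner ℂ (k z) g)
  enorm_sq : ∀ f : E, ENNReal.ofReal c * ∫⁻ z, ‖(inner ℂ (k z) f : ℂ)‖ₑ ^ 2 = ‖f‖ₑ ^ 2

namespace IsCoherentFamily

variable {c : ℝ} {k : ℂ → E}

/-- Schur's test applied to coefficient functions. The two bounds stay separate because for
compactness only `a` becomes small, while `b` is merely finite. -/
theorem enorm_sq_le (hk : IsCoherentFamily c k) {f h : E} {G : ℂ → ℂ → ℝ≥0∞}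
    (hG : Measurable (Function.uncurry G)) {a b : ℝ≥0∞}
    (ha : ∀ z, ∫⁻ w, G z w ≤ a) (hb : ∀ w, ∫⁻ z, G z w ≤ b)
    (hle : ∀ w, ‖(inner ℂ (k w) h : ℂ)‖ₑ
      ≤ ENNReal.ofReal c * ∫⁻ z, ‖(inner ℂ (k z) f : ℂ)‖ₑ * G z w) :
    ‖h‖ₑ ^ 2 ≤ ENNReal.ofReal c ^ 2 * (a * b) * ‖f‖ₑ ^ 2 := by
  have hkc := hk.continuous
  have hφ : Measurable fun z => ‖(inner ℂ (k z) f : ℂ)‖ₑ :=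
    (Continuous.inner hkc continuous_const).measurable.enorm
  rw [← hk.enorm_sq h, ← hk.enorm_sq f]
  calc ENNReal.ofReal c * ∫⁻ w, ‖(inner ℂ (k w) h : ℂ)‖ₑ ^ 2
      ≤ ENNReal.ofReal c * ∫⁻ w, (ENNReal.ofReal c
          * ∫⁻ z, ‖(inner ℂ (k z) f : ℂ)‖ₑ * G z w) ^ 2 := by
        gcongr with w
        exact hle w
    _ = ENNReal.ofReal c * (ENNReal.ofReal c ^ 2
          * ∫⁻ w, (∫⁻ z, ‖(inner ℂ (k z) f : ℂ)‖ₑ * G z w) ^ 2) := by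
        simp only [mul_pow]
        rw [lintegral_const_mul' _ _ (by simp)]
    _ ≤ ENNReal.ofReal c * (ENNReal.ofReal c ^ 2
          * (a * b * ∫⁻ z, ‖(inner ℂ (k z) f : ℂ)‖ₑ ^ 2)) := by
        gcongr
        exact lintegral_sq_lintegral_mul_le hG hφ ha hb
    _ = _ := by ring

theorem memLp_inner (hk : IsCoherentFamily c k) (f : E) :
    MemLp (fun z => (inner ℂ (k z) f : ℂ)) 2 := by
  refine ⟨(Continuous.inner hk.continuous continuous_const).aestronglyMeasurable, ?_⟩
  rw [eLpNorm_lt_top_iff_lintegral_rpow_enorm_lt_top two_ne_zero ENNReal.ofNat_ne_top]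
  simp only [ENNReal.toReal_ofNat, ENNReal.rpow_ofNat]
  have h := hk.enorm_sq f
  refine lt_top_iff_ne_top.2 fun htop => ?_
  rw [htop, ENNReal.mul_top (by simpa using hk.pos)] at h
  exact ENNReal.pow_ne_top enorm_ne_top h.symm

theorem integrable_inner_mul_inner (hk : IsCoherentFamily c k) (f g : E) :
    Integrable fun z => (c : ℂ) * ((inner ℂ f (k z) : ℂ) * inner ℂ (k z) g) := by
  refine Integrable.const_mul ?_ _
  have h := MemLp.integrable_mul (p := 2) (q := 2) (hk.memLp_inner f).star (hk.memLp_inner g)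
  refine h.congr (Eventually.of_forall fun z => ?_)
  simp

theorem continuous_inner_apply (hk : IsCoherentFamily c k) (T : E →L[ℂ] E) :
    Continuous (Function.uncurry fun z w => (inner ℂ (k w) (T (k z)) : ℂ)) := by
  have hkc := hk.continuous
  exact Continuous.inner (hkc.comp continuous_snd) (T.continuous.comp (hkc.comp continuous_fst))

theorem isCompactOperator_rankOne (x y : E) :
    IsCompactOperator (InnerProductSpace.rankOne ℂ x y) := by
  have h : IsCompactOperator (ContinuousLinearMap.toSpanSingleton ℂ x) :=
    isCompactOperator_of_locallyCompactSpace_rng _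
  have he : (InnerProductSpace.rankOne ℂ x y : E → E)
      = ContinuousLinearMap.toSpanSingleton ℂ x ∘ innerSL ℂ y := by
    ext f
    simp [InnerProductSpace.rankOne_apply]
  rw [he]
  exact h.comp_clm (innerSL ℂ y)

variable [CompleteSpace E]

theorem inner_apply_eq (hk : IsCoherentFamily c k) (T : E →L[ℂ] E) (f : E) (w : ℂ) :
    Integrable (fun z => (c : ℂ) * ((inner ℂ (k w) (T (k z)) : ℂ) * inner ℂ (k z) f)) ∧
      inner ℂ (k w) (T f)
        = ∫ z, (c : ℂ) * ((inner ℂ (k w) (T (k z)) : ℂ) * inner ℂ (k z) f) := by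
  have hi := hk.integrable_inner_mul_inner (T.adjoint (k w)) f
  have he := hk.inner_eq (T.adjoint (k w)) f
  simp only [ContinuousLinearMap.adjoint_inner_left] at hi he
  exact ⟨hi, he⟩

/-- The truncation `f ↦ c ∫_{|z| ≤ R} ⟨k z, f⟩ T (k z) dz` of an operator `T`. -/
def truncation (c : ℝ) (k : ℂ → E) (T : E →L[ℂ] E) (R : ℝ) : E →L[ℂ] E :=
  ∫ z in Metric.closedBall 0 R, c • InnerProductSpace.rankOne ℂ (T (k z)) (k z)

theorem continuous_rankOne (hk : IsCoherentFamily c k) (T : E →L[ℂ] E) :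
    Continuous fun z => c • InnerProductSpace.rankOne ℂ (T (k z)) (k z) := by
  have hkc := hk.continuous
  have h : Continuous fun z => innerSL ℂ (k z) := (innerSL ℂ (E := E)).continuous.comp hkc
  have h' : Continuous fun z => InnerProductSpace.rankOne ℂ (T (k z)) (k z) :=
    ((ContinuousLinearMap.smulRightL ℂ E E).continuous.comp h).clm_apply (T.continuous.comp hkc)
  exact h'.const_smul c

theorem integrableOn_rankOne (hk : IsCoherentFamily c k) (T : E →L[ℂ] E) (R : ℝ) :
    IntegrableOn (fun z => c • InnerProductSpace.rankOne ℂ (T (k z)) (k z))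
      (Metric.closedBall 0 R) :=
  (hk.continuous_rankOne T).continuousOn.integrableOn_compact (isCompact_closedBall 0 R)

theorem inner_truncation_apply (hk : IsCoherentFamily c k) (T : E →L[ℂ] E) (R : ℝ) (f g : E) :
    inner ℂ g (truncation c k T R f) = ∫ z in Metric.closedBall 0 R,
      (c : ℂ) * ((inner ℂ g (T (k z)) : ℂ) * inner ℂ (k z) f) := by
  have h := ((innerSL ℂ g).comp (ContinuousLinearMap.apply ℂ E f)).integral_comp_comm
    (hk.integrableOn_rankOne T R)
  simp only [ContinuousLinearMap.comp_apply, ContinuousLinearMap.apply_apply,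
    innerSL_apply_apply] at h
  rw [truncation, ← h]
  refine integral_congr_ae (Eventually.of_forall fun z => ?_)
  simp only [smul_apply, InnerProductSpace.rankOne_apply]
  rw [← Complex.coe_smul, inner_smul_right, inner_smul_right, mul_comm (inner ℂ (k z) f)]

/-- Up to the volume of the ball, the truncation is an average of rank one operators, and the
compact operators form a closed convex set. -/
theorem isCompactOperator_truncation (hk : IsCoherentFamily c k) (T : E →L[ℂ] E) {R : ℝ}
    (hR : 0 < R) : IsCompactOperator (truncation c k T R) := by
  have hconv : Convex ℝ (compactOperator (RingHom.id ℂ) E E : Set (E →L[ℂ] E)) :=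
    ((compactOperator (RingHom.id ℂ) E E).restrictScalars ℝ).convex
  have hclosed : IsClosed (compactOperator (RingHom.id ℂ) E E : Set (E →L[ℂ] E)) :=
    isClosed_setOfPred_isCompactOperator
  have hmem := hconv.set_average_mem (μ := volume) (t := Metric.closedBall (0 : ℂ) R) hclosed
    (Metric.measure_closedBall_pos volume 0 hR).ne' measure_closedBall_lt_top.ne
    (Eventually.of_forall fun z => (isCompactOperator_rankOne (T (k z)) (k z)).smul c)
    (hk.integrableOn_rankOne T R)
  have := ((compactOperator (RingHom.id ℂ) E E).restrictScalars ℝ).smul_mem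
    (volume.real (Metric.closedBall (0 : ℂ) R)) hmem
  rw [measure_smul_setAverage _ measure_closedBall_lt_top.ne] at this
  exact this

/-- Required for dominated convergence along `cocompact ℂ`. -/
theorem isCountablyGenerated_cocompact : (cocompact ℂ).IsCountablyGenerated := by
  rw [← Metric.cobounded_eq_cocompact, ← comap_norm_atTop]
  infer_instance

/-- An operator whose matrix with respect to a coherent family has Gaussian decay off the diagonal
and tends to zero along the diagonals is compact. -/
theorem isCompactOperator_of_tendsto (hk : IsCoherentFamily c k) (T : E →L[ℂ] E) {M δ : ℝ}
    (hδ : 0 < δ)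
    (hbd : ∀ z w, ‖(inner ℂ (k w) (T (k z)) : ℂ)‖ ≤ M * Real.exp (-δ * ‖z - w‖ ^ 2))
    (hlim : ∀ u, Tendsto (fun z => (inner ℂ (k (z - u)) (T (k z)) : ℂ)) (cocompact ℂ) (𝓝 0)) :
    IsCompactOperator T := by
  have hcg := isCountablyGenerated_cocompact
  have hcont := hk.continuous_inner_apply T
  let B (u : ℂ) : ℝ≥0∞ := ENNReal.ofReal (M * Real.exp (-δ * ‖u‖ ^ 2))
  have hB : ∫⁻ u, B u ≠ ∞ :=
    (((Fock.integrable_exp_neg_mul_sq_norm hδ).const_mul M).lintegral_lt_top).ne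
  have hGB (z w : ℂ) : ‖(inner ℂ (k w) (T (k z)) : ℂ)‖ₑ ≤ B (z - w) := by
    rw [← ofReal_norm]
    exact ENNReal.ofReal_le_ofReal (hbd z w)
  -- The substitution `w = z - u` gives a majorant `B u` independent of `z`, while the integrand
  -- tends to zero for each fixed `u`.
  have hA : Tendsto (fun z => ∫⁻ w, ‖(inner ℂ (k w) (T (k z)) : ℂ)‖ₑ) (cocompact ℂ) (𝓝 0) := by
    have h1 (z : ℂ) : ∫⁻ w, ‖(inner ℂ (k w) (T (k z)) : ℂ)‖ₑ
        = ∫⁻ u, ‖(inner ℂ (k (z - u)) (T (k z)) : ℂ)‖ₑ :=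
      (lintegral_sub_left_eq_self (fun w => ‖(inner ℂ (k w) (T (k z)) : ℂ)‖ₑ) z).symm
    simp only [h1]
    rw [← lintegral_zero (α := ℂ) (μ := volume)]
    refine tendsto_lintegral_filter_of_dominated_convergence B ?_ ?_ hB ?_
    · refine Eventually.of_forall fun z => Measurable.enorm (Continuous.measurable ?_)
      exact hcont.comp (by fun_prop : Continuous fun u => (z, z - u))
    · refine Eventually.of_forall fun z => Eventually.of_forall fun u => ?_
      simpa using hGB z (z - u)
    · refine Eventually.of_forall fun u => ?_
      simpa using (hlim u).enorm
  have hmem : T ∈ closure {A : E →L[ℂ] E | IsCompactOperator A} := by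
    rw [Metric.mem_closure_iff]
    intro ε hε
    have hη : ∃ η : ℝ≥0∞, 0 < η ∧ ENNReal.ofReal c ^ 2 * (η * ∫⁻ u, B u)
        ≤ ENNReal.ofReal (ε / 2) ^ 2 := by
      have hK : ENNReal.ofReal c ^ 2 * ∫⁻ u, B u ≠ ∞ := ENNReal.mul_ne_top (by simp) hB
      have h0 : 0 < ENNReal.ofReal (ε / 2) ^ 2 := by
        have : 0 < ENNReal.ofReal (ε / 2) := by simpa using hε
        positivity
      -- Chosen so that the Schur bound `c² η ∫ B` is at most `(ε/2)²`. If the denominator vanishes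
      -- the quotient is `∞`, which is still admissible.
      refine ⟨ENNReal.ofReal (ε / 2) ^ 2 / (ENNReal.ofReal c ^ 2 * ∫⁻ u, B u),
        ENNReal.div_pos h0.ne' hK, ?_⟩
      rw [mul_left_comm, mul_comm]
      exact ENNReal.mul_div_le
    obtain ⟨η, hη0, hη⟩ := hη
    obtain ⟨R, hR0, hR⟩ : ∃ R : ℝ, 0 < R ∧ ∀ z : ℂ, z ∉ Metric.closedBall (0 : ℂ) R →
        ∫⁻ w, ‖(inner ℂ (k w) (T (k z)) : ℂ)‖ₑ ≤ η := by
      have h := hA.eventually_le_const hη0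
      rw [← Metric.cobounded_eq_cocompact, ← comap_norm_atTop, eventually_comap,
        eventually_atTop] at h
      obtain ⟨R, hR⟩ := h
      refine ⟨max R 1, by positivity, fun z hz => hR ‖z‖ ?_ z rfl⟩
      rw [mem_closedBall_zero_iff, not_le] at hz
      exact (le_max_left _ _).trans hz.le
    refine ⟨truncation c k T R, hk.isCompactOperator_truncation T hR0, ?_⟩
    rw [dist_eq_norm]
    refine lt_of_le_of_lt (ContinuousLinearMap.opNorm_le_bound _ (half_pos hε).le fun f => ?_)
      (half_lt_self hε)
    -- The matrix of `T - truncation c k T R`: only `z` outside the ball survive, where the integral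
    -- over `w` is at most `η`.
    let G (z w : ℂ) : ℝ≥0∞ := (Metric.closedBall (0 : ℂ) R)ᶜ.indicator
      (fun z => ‖(inner ℂ (k w) (T (k z)) : ℂ)‖ₑ) z
    have hGm : Measurable (Function.uncurry G) := by
      have : Function.uncurry G = (Prod.fst ⁻¹' (Metric.closedBall (0 : ℂ) R)ᶜ).indicator
          (fun p => ‖(Function.uncurry fun z w => (inner ℂ (k w) (T (k z)) : ℂ)) p‖ₑ) := by
        ext p
        rfl
      rw [this]
      exact hcont.measurable.enorm.indicator
        (measurable_fst Metric.isClosed_closedBall.measurableSet.compl)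
    have h := hk.enorm_sq_le (f := f) (h := (T - truncation c k T R) f) hGm (a := η)
      (b := ∫⁻ u, B u) ?_ ?_ ?_
    · have h2 : ‖(T - truncation c k T R) f‖ₑ ^ 2 ≤ (ENNReal.ofReal (ε / 2) * ‖f‖ₑ) ^ 2 := by
        refine h.trans ?_
        rw [mul_pow]
        gcongr
      have h3 := (ENNReal.pow_le_pow_left_iff two_ne_zero).1 h2
      rw [← ofReal_norm, ← ofReal_norm, ← ENNReal.ofReal_mul (by positivity)] at h3
      exact (ENNReal.ofReal_le_ofReal_iff (by positivity)).1 h3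
    · intro z
      by_cases hz : z ∈ Metric.closedBall (0 : ℂ) R
      · simp [G, hz]
      · simpa [G, hz] using hR z hz
    · intro w
      calc ∫⁻ z, G z w ≤ ∫⁻ z, B (z - w) :=
            lintegral_mono fun z => (Set.indicator_le_self' (by simp) z).trans (hGB z w)
        _ = ∫⁻ u, B u := lintegral_sub_right_eq_self B w
    · intro w
      obtain ⟨hi, he⟩ := hk.inner_apply_eq T f w
      rw [sub_apply, inner_sub_right, he, hk.inner_truncation_apply,
        ← integral_add_compl Metric.isClosed_closedBall.measurableSet hi, add_sub_cancel_left]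
      refine (enorm_integral_le_lintegral_enorm _).trans ?_
      rw [← lintegral_const_mul' _ _ ENNReal.ofReal_ne_top,
        ← lintegral_indicator Metric.isClosed_closedBall.measurableSet.compl]
      refine lintegral_mono fun z => ?_
      by_cases hz : z ∈ Metric.closedBall (0 : ℂ) R
      · simp [hz]
      · have hc : ‖(c : ℂ)‖ₑ = ENNReal.ofReal c := by
          rw [← ofReal_norm, Complex.norm_real, Real.norm_of_nonneg hk.pos.le]
        rw [Set.indicator_of_mem hz]
        simp only [G]
        rw [Set.indicator_of_mem hz, enorm_mul, enorm_mul, hc, mul_comm ‖_‖ₑ ‖_‖ₑ]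
  rwa [isClosed_setOfPred_isCompactOperator.closure_eq] at hmem

end IsCoherentFamily

end CoherentStates

/-! ### Vector valued holomorphy, injectivity of the Berezin transform and weak limits. -/

/-- A continuous vector valued function that is holomorphic against a dense set of functionals
is holomorphic. -/
theorem differentiable_of_differentiable_inner {E : Type*} [NormedAddCommGroup E]
    [InnerProductSpace ℂ E] [CompleteSpace E] {F : ℂ → E} (hF : Continuous F) {s : Set E}
    (hs : Dense (Submodule.span ℂ s : Set E))
    (h : ∀ v ∈ s, Differentiable ℂ fun z => (inner ℂ v (F z) : ℂ)) : Differentiable ℂ F := by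
  intro z₀
  have hci : CircleIntegrable F z₀ (1 : NNReal) := hF.continuousOn.circleIntegrable (by simp)
  -- The Cauchy integral of a merely continuous `F` is already analytic in the disc; it remains to
  -- see that it equals `F`, which can be tested against the dense span.
  have hp := hasFPowerSeriesOn_cauchy_integral hci one_pos
  refine (hp.differentiableOn.congr fun z hz => ?_).differentiableAt
    (Metric.eball_mem_nhds z₀ (by simp))
  refine hs.eq_of_inner_right (𝕜 := ℂ) ?_
  intro v hv
  have hv' : ∀ v ∈ Submodule.span ℂ s, (inner ℂ v (F z) : ℂ) = inner ℂ v
      ((2 * Real.pi * Complex.I : ℂ)⁻¹ • ∮ w in C(z₀, (1 : NNReal)), (w - z)⁻¹ • F w) := by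
    intro v hv
    induction hv using Submodule.span_induction with
    | mem v hv =>
      have hball : z ∈ Metric.ball z₀ (1 : NNReal) := by
        simpa [edist_dist, ← ENNReal.ofReal_one] using hz
      have hc := ((h v hv).differentiableOn (s := Metric.closedBall z₀ (1 : NNReal))
        ).circleIntegral_sub_inv_smul hball
      rw [inner_smul_right, eq_inv_mul_iff_mul_eq₀ Complex.two_pi_I_ne_zero, ← smul_eq_mul, ← hc,
        ← innerSL_apply_apply ℂ, circleIntegral, circleIntegral,
        ← ContinuousLinearMap.intervalIntegral_comp_comm]
      · simp
      · refine (ContinuousOn.circleIntegrable (c := z₀) (R := (1 : NNReal))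
          (f := fun w => (w - z)⁻¹ • F w) NNReal.zero_le_coe ?_).out
        refine ContinuousOn.smul (ContinuousOn.inv₀ (by fun_prop) fun w hw h0 => ?_)
          hF.continuousOn
        rw [sub_eq_zero.1 h0] at hw
        exact (Metric.mem_ball.1 hball).ne (Metric.mem_sphere.1 hw)
    | zero => simp
    | add x y _ _ hx hy => rw [inner_add_left, inner_add_left, hx, hy]
    | smul a x _ hx => rw [inner_smul_left, inner_smul_left, hx]
  exact hv' v hv

theorem differentiable_antilinear_comp_conj {E F : Type*} [NormedAddCommGroup E] [NormedSpace ℂ E]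
    [NormedAddCommGroup F] [NormedSpace ℂ F] (L : E →L⋆[ℂ] F) {f : ℂ → E}
    (hf : Differentiable ℂ f) : Differentiable ℂ fun z => L (f (conj z)) := by
  intro z
  have h := (hf (conj z)).hasDerivAt
  refine HasDerivAt.differentiableAt (f' := L (deriv f (conj z))) ?_
  rw [hasDerivAt_iff_tendsto_slope] at h ⊢
  have hc : Tendsto (conj : ℂ → ℂ) (𝓝[≠] z) (𝓝[≠] (conj z)) := by
    refine tendsto_nhdsWithin_of_tendsto_nhds_of_eventually_within _
      (Complex.continuous_conj.tendsto z |>.mono_left nhdsWithin_le_nhds) ?_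
    filter_upwards [self_mem_nhdsWithin] with w hw
    exact fun h => hw (star_injective h)
  refine ((L.continuous.tendsto _).comp (h.comp hc)).congr fun w => ?_
  simp [slope_def_module]

theorem eq_zero_of_forall_ofReal_eq_zero {f : ℂ → ℂ} (hf : Differentiable ℂ f)
    (h : ∀ x : ℝ, f x = 0) (z : ℂ) : f z = 0 := by
  have hfr : ∃ᶠ w in 𝓝[≠] (0 : ℂ), f w = (fun _ => (0 : ℂ)) w := by
    have ht : Tendsto (fun x : ℝ => (x : ℂ)) (𝓝[≠] 0) (𝓝[≠] 0) := by
      refine tendsto_nhdsWithin_of_tendsto_nhds_of_eventually_within _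
        ((Complex.continuous_ofReal.tendsto' 0 0 (by simp)).mono_left nhdsWithin_le_nhds) ?_
      filter_upwards [self_mem_nhdsWithin] with w hw
      simpa using hw
    exact ht.frequently (Frequently.of_forall h)
  exact congrFun (AnalyticOnNhd.eq_of_frequently_eq
    (fun z _ => hf.analyticAt z) (fun z _ => analyticAt_const) hfr) z

/-- A bounded operator whose Berezin transform vanishes has vanishing matrix elements between
kernels. -/
theorem inner_kernel_eq_zero_of_diagonal {E : Type*} [NormedAddCommGroup E] [InnerProductSpace ℂ E]
    {K : ℂ → E} (hK : Differentiable ℂ fun z => K (conj z)) (B : E →L[ℂ] E)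
    (h : ∀ u, (inner ℂ (K u) (B (K u)) : ℂ) = 0) (u v : ℂ) : (inner ℂ (K v) (B (K u)) : ℂ) = 0 := by
  have hL : Differentiable ℂ fun b => innerSL ℂ (K b) := by
    simpa using differentiable_antilinear_comp_conj (innerSL ℂ (E := E)) hK
  have hH {a b : ℂ → ℂ} (ha : Differentiable ℂ a) (hb : Differentiable ℂ b) :
      Differentiable ℂ fun x => (inner ℂ (K (b x)) (B (K (conj (a x)))) : ℂ) := by
    have h1 : Differentiable ℂ fun x => innerSL ℂ (K (b x)) := hL.comp hb
    have h2 : Differentiable ℂ fun x => B (K (conj (a x))) :=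
      B.differentiable.comp (hK.comp ha)
    simpa using h1.clm_apply h2
  -- For real `x`, `y` the points `x + iy` and `x - iy` are conjugate, so this is the diagonal. The
  -- expression is entire in each of `x` and `y`, and the identity theorem frees them one at a time.
  have h1 (x y : ℝ) : (inner ℂ (K (x - Complex.I * y))
      (B (K (conj (x + Complex.I * y : ℂ)))) : ℂ) = 0 := by
    have : conj (x + Complex.I * y : ℂ) = x - Complex.I * y := by simp [sub_eq_add_neg]
    rw [this, h]
  have h2 (x : ℂ) (y : ℝ) : (inner ℂ (K (x - Complex.I * y))
      (B (K (conj (x + Complex.I * y : ℂ)))) : ℂ) = 0 :=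
    eq_zero_of_forall_ofReal_eq_zero (hH (a := fun x => x + Complex.I * y)
      (b := fun x => x - Complex.I * y) (by fun_prop) (by fun_prop)) (fun x => h1 x y) x
  have h3 (x y : ℂ) : (inner ℂ (K (x - Complex.I * y))
      (B (K (conj (x + Complex.I * y : ℂ)))) : ℂ) = 0 :=
    eq_zero_of_forall_ofReal_eq_zero (hH (a := fun y => x + Complex.I * y)
      (b := fun y => x - Complex.I * y) (by fun_prop) (by fun_prop)) (fun y => h2 x y) y
  -- The solution of `x + iy = conj u`, `x - iy = v`.
  have h4 := h3 ((conj u + v) / 2) ((conj u - v) / (2 * Complex.I))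
  have hI := Complex.I_ne_zero
  convert h4 using 3
  · field_simp
    ring
  · congr 1
    apply star_injective
    simp only [Complex.star_def, Complex.conj_conj]
    field_simp
    ring

/-- Bounded families of operators have weak limits along ultrafilters. -/
theorem exists_tendsto_inner_ultrafilter {ι E : Type*} [NormedAddCommGroup E]
    [InnerProductSpace ℂ E] [CompleteSpace E] (𝒰 : Ultrafilter ι) (A : ι → E →L[ℂ] E) {M : ℝ}
    (hA : ∀ i, ‖A i‖ ≤ M) :
    ∃ B : E →L[ℂ] E, ∀ f g : E, Tendsto (fun i => (inner ℂ g (A i f) : ℂ)) 𝒰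
      (𝓝 (inner ℂ g (B f))) := by
  have hbd (f g : E) (i : ι) : ‖(inner ℂ (A i f) g : ℂ)‖ ≤ M * ‖f‖ * ‖g‖ := by
    refine (norm_inner_le_norm _ _).trans ?_
    gcongr
    exact (A i).le_of_opNorm_le (hA i) f
  have hlim (f g : E) : ∃ b : ℂ, ‖b‖ ≤ M * ‖f‖ * ‖g‖ ∧
      Tendsto (fun i => (inner ℂ (A i f) g : ℂ)) 𝒰 (𝓝 b) := by
    obtain ⟨b, hb, hb'⟩ := (isCompact_closedBall (0 : ℂ) (M * ‖f‖ * ‖g‖)).ultrafilter_le_nhds'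
      (𝒰.map fun i => (inner ℂ (A i f) g : ℂ))
      (Ultrafilter.mem_map.2 (Eventually.of_forall fun i => by simpa using hbd f g i))
    exact ⟨b, by simpa using hb, hb'⟩
  choose b hb hbt using hlim
  -- The limits `b f g` form a bounded sesquilinear form, which the Riesz theorem represents by an
  -- operator; its convention puts `A i f` in the conjugate linear slot, hence the conjugation at
  -- the end.
  let L : E →ₗ⋆[ℂ] E →ₗ[ℂ] ℂ := LinearMap.mk₂'ₛₗ (starRingEnd ℂ) (RingHom.id ℂ) b
    (fun f f' g => tendsto_nhds_unique (hbt _ _)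
      (((hbt f g).add (hbt f' g)).congr fun i => by rw [map_add, inner_add_left]))
    (fun c f g => tendsto_nhds_unique (hbt _ _)
      (((hbt f g).const_mul (conj c)).congr fun i => by rw [map_smul, inner_smul_left]))
    (fun f g g' => tendsto_nhds_unique (hbt _ _)
      (((hbt f g).add (hbt f g')).congr fun i => by rw [inner_add_right]))
    (fun c f g => tendsto_nhds_unique (hbt _ _)
      (((hbt f g).const_mul c).congr fun i => by rw [inner_smul_right]))
  let L' : E →L⋆[ℂ] E →L[ℂ] ℂ := L.mkContinuous₂ M fun f g => hb f g
  refine ⟨InnerProductSpace.continuousLinearMapOfBilin L', fun f g => ?_⟩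
  have h1 : (inner ℂ g (InnerProductSpace.continuousLinearMapOfBilin L' f) : ℂ)
      = conj (b f g) := by
    rw [← inner_conj_symm, InnerProductSpace.continuousLinearMapOfBilin_apply]
    rfl
  rw [h1]
  exact ((Complex.continuous_conj.tendsto _).comp (hbt f g)).congr fun i => inner_conj_symm _ _

/-- A compact operator maps bounded weakly null families to families with null matrix elements. -/
theorem IsCompactOperator.tendsto_inner_zero {ι E : Type*} [NormedAddCommGroup E]
    [InnerProductSpace ℂ E] [CompleteSpace E] {T : E →L[ℂ] E} (hT : IsCompactOperator T)
    {l : Filter ι} {k : ι → E} (hk : ∀ i, ‖k i‖ = 1)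
    (hw : ∀ g : E, Tendsto (fun i => (inner ℂ g (k i) : ℂ)) l (𝓝 0)) :
    Tendsto (fun i => (inner ℂ (k i) (T (k i)) : ℂ)) l (𝓝 0) := by
  rw [tendsto_iff_ultrafilter]
  intro 𝒰 h𝒰
  obtain ⟨s, hs, hsub⟩ := hT.image_closedBall_subset_compact (f := (T : E →ₗ[ℂ] E)) 1
  obtain ⟨y, -, hy⟩ := hs.ultrafilter_le_nhds' (𝒰.map fun i => T (k i))
    (Ultrafilter.mem_map.2 (Eventually.of_forall fun i => hsub ⟨k i, by simp [hk], rfl⟩))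
  have hy : Tendsto (fun i => T (k i)) 𝒰 (𝓝 y) := hy
  -- Moving `T` to the other side tests the weakly null family against the fixed vector `T* y`, so
  -- `‖y‖² = 0`.
  have hy0 : y = 0 := by
    have h1 : Tendsto (fun i => (inner ℂ y (T (k i)) : ℂ)) 𝒰 (𝓝 (inner ℂ y y)) :=
      tendsto_const_nhds.inner hy
    have h2 := (hw (T.adjoint y)).mono_left h𝒰
    simp only [ContinuousLinearMap.adjoint_inner_left] at h2
    exact inner_self_eq_zero.1 (tendsto_nhds_unique h1 h2)
  have hn : Tendsto (fun i => ‖T (k i)‖) 𝒰 (𝓝 0) := by simpa [hy0] using hy.norm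
  refine squeeze_zero_norm (fun i => ?_) hn
  simpa [hk] using norm_inner_le_norm (𝕜 := ℂ) (k i) (T (k i))

/-! ### Gaussian off-diagonal decay, boundedness, and limits along the diagonals. -/

namespace Fock

theorem isCoherentFamily {α : ℝ} (hα : 0 < α) :
    IsCoherentFamily (α / Real.pi) (normalizedKernel hα) where
  pos := by positivity
  continuous := continuous_normalizedKernel hα
  norm_eq := norm_normalizedKernel hα
  inner_eq := inner_eq_integral_normalizedKernel hα
  enorm_sq := lintegral_enorm_inner_normalizedKernel hα

/-- Completing the square turns `|K_u|^q` times the weight into a Gaussian centred at `(q/2) u`,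
with the constant `exp(αq²|u|²/4)` left over. -/
theorem lintegral_enorm_kernelFun_rpow {α : ℝ} (hα : 0 < α) (u : ℂ) (q : ℝ) :
    ∫⁻ z, ‖kernelFun α u z‖ₑ ^ q ∂gaussianMeasure α
      = ENNReal.ofReal (Real.exp (α * q ^ 2 / 4 * ‖u‖ ^ 2)) := by
  have h1 (z : ℂ) : ‖kernelFun α u z‖ₑ ^ q
      = ENNReal.ofReal (Real.exp (q * (α * z * conj u).re)) := by
    rw [kernelFun, ← ofReal_norm, Complex.norm_exp,
      ENNReal.ofReal_rpow_of_pos (Real.exp_pos _), ← Real.exp_mul, mul_comm]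
  have h2 (z : ℂ) : α / Real.pi * Real.exp (-α * ‖z‖ ^ 2) * Real.exp (q * (α * z * conj u).re)
      = α / Real.pi * Real.exp (α * q ^ 2 / 4 * ‖u‖ ^ 2)
        * Real.exp (-α * ‖z - (q / 2 : ℝ) * u‖ ^ 2) := by
    rw [mul_assoc (α / Real.pi), mul_assoc (α / Real.pi), ← Real.exp_add, ← Real.exp_add]
    congr 2
    simp only [Complex.sq_norm, Complex.normSq_apply]
    simp
    ring
  have hg : Measurable fun z => ‖kernelFun α u z‖ₑ ^ q :=
    (differentiable_kernelFun α u).continuous.measurable.enorm.pow_const q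
  rw [gaussianMeasure, lintegral_withDensity_eq_lintegral_mul _ (by fun_prop) hg]
  simp only [Pi.mul_apply, h1]
  have h3 (z : ℂ) : ENNReal.ofReal (α / Real.pi * Real.exp (-α * ‖z‖ ^ 2))
      * ENNReal.ofReal (Real.exp (q * (α * z * conj u).re))
      = ENNReal.ofReal (α / Real.pi * Real.exp (α * q ^ 2 / 4 * ‖u‖ ^ 2)
        * Real.exp (-α * ‖z - (q / 2 : ℝ) * u‖ ^ 2)) := by
    rw [← ENNReal.ofReal_mul (by positivity), h2]
  simp only [h3]
  rw [← ofReal_integral_eq_lintegral_ofReal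
    (((integrable_exp_neg_mul_sq_norm hα).comp_sub_right _).const_mul _)
    (Eventually.of_forall fun z => by positivity), integral_const_mul,
    integral_sub_right_eq_self (fun z : ℂ => Real.exp (-α * ‖z‖ ^ 2)),
    integral_exp_neg_mul_sq_norm hα]
  congr 1
  have := Real.pi_pos.ne'
  have := hα.ne'
  field_simp

/-- Pointwise growth of functions in the Fock space that belong to `Lᵖ`. -/
theorem norm_toEntire_le {α : ℝ} (hα : 0 < α) (f : space α) {p q C : ℝ}
    (hpq : p.HolderConjugate q) (hC : 0 ≤ C)
    (hf : eLpNorm (f : Lp ℂ 2 (gaussianMeasure α)) (ENNReal.ofReal p) (gaussianMeasure α)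
      ≤ ENNReal.ofReal C) (u : ℂ) :
    ‖toEntire f u‖ ≤ C * Real.exp (α * q / 4 * ‖u‖ ^ 2) := by
  have hp0 : 0 < p := hpq.pos
  have hq0 : 0 < q := hpq.symm.pos
  rw [eLpNorm_congr_ae (coe_ae_eq_toEntire f),
    eLpNorm_eq_lintegral_rpow_enorm_toReal (by simpa using hp0) ENNReal.ofReal_ne_top,
    ENNReal.toReal_ofReal hp0.le] at hf
  have hfm : Measurable fun z => ‖toEntire f z‖ₑ :=
    (differentiable_toEntire f).continuous.measurable.enorm
  have hkm : Measurable fun z => ‖kernelFun α u z‖ₑ :=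
    (differentiable_kernelFun α u).continuous.measurable.enorm
  have h : ‖toEntire f u‖ₑ
      ≤ ENNReal.ofReal C * ENNReal.ofReal (Real.exp (α * q / 4 * ‖u‖ ^ 2)) :=
    calc ‖toEntire f u‖ₑ
        = ‖∫ z, conj (kernelFun α u z) * toEntire f z ∂gaussianMeasure α‖ₑ := by
          rw [integral_conj_kernelFun_mul hα u (differentiable_toEntire f) (memLp_toEntire f)]
      _ ≤ ∫⁻ z, ‖toEntire f z‖ₑ * ‖kernelFun α u z‖ₑ ∂gaussianMeasure α := by
          refine (enorm_integral_le_lintegral_enorm _).trans (lintegral_mono fun z => ?_)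
          rw [enorm_mul, mul_comm, ← ofReal_norm (conj _), RCLike.norm_conj, ofReal_norm]
      _ ≤ (∫⁻ z, ‖toEntire f z‖ₑ ^ p ∂gaussianMeasure α) ^ (1 / p)
          * (∫⁻ z, ‖kernelFun α u z‖ₑ ^ q ∂gaussianMeasure α) ^ (1 / q) :=
          ENNReal.lintegral_mul_le_Lp_mul_Lq _ hpq hfm.aemeasurable hkm.aemeasurable
      _ ≤ _ := by
          gcongr
          rw [lintegral_enorm_kernelFun_rpow hα, ENNReal.ofReal_rpow_of_pos (Real.exp_pos _),
            ← Real.exp_mul]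
          refine ENNReal.ofReal_le_ofReal (Real.exp_le_exp.2 (le_of_eq ?_))
          field_simp
  rw [← ofReal_norm, ← ENNReal.ofReal_mul hC] at h
  exact (ENNReal.ofReal_le_ofReal_iff (by positivity)).1 h

/-- Since `S_z 1 = U_z S k_z`, the coefficient has modulus `exp(-(α/2)|z-w|²) |(S_z 1)(z-w)|`. The
growth bound for `S_z 1` costs `αq/4` in the exponent, uniformly in `z`. -/
theorem norm_inner_normalizedKernel_apply_le {α : ℝ} (hα : 0 < α)
    {S : space α →ₗ.[ℂ] space α} (hdom : kernelSpan hα ≤ S.domain) {p q C : ℝ}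
    (hpq : p.HolderConjugate q) (hC : 0 ≤ C)
    (hbound : ∀ z : ℂ,
      eLpNorm (conjugate hα S z ⟨one hα, one_mem_domain hα hdom z⟩ : Lp ℂ 2 (gaussianMeasure α))
        (ENNReal.ofReal p) (gaussianMeasure α) ≤ ENNReal.ofReal C) (z w : ℂ) :
    ‖(inner ℂ (normalizedKernel hα w)
        (S ⟨normalizedKernel hα z, hdom (normalizedKernel_mem hα z)⟩) : ℂ)‖
      ≤ C * Real.exp (-(α / 2 - α * q / 4) * ‖z - w‖ ^ 2) := by
  have hconj : conjugate hα S z ⟨one hα, one_mem_domain hα hdom z⟩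
      = U hα z (S ⟨normalizedKernel hα z, hdom (normalizedKernel_mem hα z)⟩) := by
    have : (⟨U hα z (one hα), one_mem_domain hα hdom z⟩ : S.domain)
        = ⟨normalizedKernel hα z, hdom (normalizedKernel_mem hα z)⟩ := Subtype.ext (U_one hα z)
    rw [← this]
    rfl
  have h := norm_toEntire_le hα _ hpq hC (hbound z) (z - w)
  rw [hconj] at h
  have h2 := norm_inner_normalizedKernel_U hα z (z - w)
    (S ⟨normalizedKernel hα z, hdom (normalizedKernel_mem hα z)⟩)
  rw [sub_sub_cancel] at h2
  rw [← h2, inner_normalizedKernel, norm_mul, Complex.norm_real,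
    Real.norm_of_nonneg (Real.exp_pos _).le]
  refine (mul_le_mul_of_nonneg_left h (Real.exp_pos _).le).trans (le_of_eq ?_)
  rw [mul_left_comm, ← Real.exp_add]
  congr 2
  ring

/-- A densely defined operator with Gaussian decay of its matrix off the diagonal is bounded. -/
theorem exists_norm_apply_le {α : ℝ} (hα : 0 < α) {S : space α →ₗ.[ℂ] space α}
    (hdom : kernelSpan hα ≤ S.domain) (hadj : kernelSpan hα ≤ S.adjointDomain) {C δ : ℝ}
    (hδ : 0 < δ) (hbd : ∀ z w, ‖(inner ℂ (normalizedKernel hα w)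
      (S ⟨normalizedKernel hα z, hdom (normalizedKernel_mem hα z)⟩) : ℂ)‖
        ≤ C * Real.exp (-δ * ‖z - w‖ ^ 2)) :
    ∃ M : ℝ, ∀ f : S.domain, ‖S f‖ ≤ M * ‖f‖ := by
  have := completeSpace hα
  have hdense : Dense (S.domain : Set (space α)) := (dense_kernelSpan hα).mono hdom
  have hk := isCoherentFamily hα
  let B (u : ℂ) : ℝ≥0∞ := ENNReal.ofReal (C * Real.exp (-δ * ‖u‖ ^ 2))
  have hB : ∫⁻ u, B u ≠ ∞ :=
    (((integrable_exp_neg_mul_sq_norm hδ).const_mul C).lintegral_lt_top).ne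
  let K : ℝ≥0∞ := ENNReal.ofReal (α / Real.pi) * ∫⁻ u, B u
  have hK : K ≠ ∞ := ENNReal.mul_ne_top ENNReal.ofReal_ne_top hB
  refine ⟨K.toReal, fun f => ?_⟩
  have h := hk.enorm_sq_le (f := (f : space α)) (h := S f) (G := fun z w => B (z - w))
    (by unfold Function.uncurry; fun_prop) (a := ∫⁻ u, B u) (b := ∫⁻ u, B u)
    (fun z => (lintegral_sub_left_eq_self B z).le) (fun w => (lintegral_sub_right_eq_self B w).le)
    ?_
  · have h2 : ‖S f‖ₑ ^ 2 ≤ (K * ‖(f : space α)‖ₑ) ^ 2 := h.trans_eq (by simp only [K]; ring)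
    have h3 := (ENNReal.pow_le_pow_left_iff two_ne_zero).1 h2
    rw [← ofReal_norm, ← ofReal_norm, ← ENNReal.ofReal_toReal hK,
      ← ENNReal.ofReal_mul (by positivity)] at h3
    exact (ENNReal.ofReal_le_ofReal_iff (by positivity)).1 h3
  · intro w
    -- A general `f` in the domain need not lie in the span of the kernels, so `S` cannot be applied
    -- under the integral. Instead `⟨f, S* k_w⟩` is expanded, and `S*` is moved back only against
    -- `k_z`.
    have hadj' := LinearPMap.adjoint_isFormalAdjoint hdense
      ⟨normalizedKernel hα w, hadj (normalizedKernel_mem hα w)⟩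
    rw [← hadj' f, inner_eq_integral_normalizedKernel hα]
    refine (enorm_integral_le_lintegral_enorm _).trans ?_
    rw [← lintegral_const_mul' _ _ ENNReal.ofReal_ne_top]
    refine lintegral_mono fun z => ?_
    have hz := hadj' ⟨normalizedKernel hα z, hdom (normalizedKernel_mem hα z)⟩
    simp only at hz
    rw [hz, enorm_mul, enorm_mul, ← ofReal_norm, Complex.norm_real, Real.norm_of_nonneg hk.pos.le,
      mul_comm ‖_‖ₑ ‖_‖ₑ]
    gcongr
    rw [← ofReal_norm]
    exact ENNReal.ofReal_le_ofReal (hbd z w)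

theorem differentiable_kernel_conj {α : ℝ} (hα : 0 < α) :
    Differentiable ℂ fun z => kernel hα (conj z) := by
  have := completeSpace hα
  refine differentiable_of_differentiable_inner
    ((continuous_kernel hα).comp Complex.continuous_conj) (dense_kernelSpan hα) ?_
  rintro _ ⟨w, rfl⟩
  simp only [inner_kernel_kernel, Complex.conj_conj]
  fun_prop

/-- Against a fixed kernel the inner product is a Gaussian in `z`; density of the kernels and `‖k_z‖
= 1` give the general case. -/
theorem tendsto_inner_normalizedKernel {α : ℝ} (hα : 0 < α) (g : space α) :
    Tendsto (fun z => (inner ℂ g (normalizedKernel hα z) : ℂ)) (cocompact ℂ) (𝓝 0) := by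
  have hspan : ∀ h ∈ kernelSpan hα,
      Tendsto (fun z => (inner ℂ h (normalizedKernel hα z) : ℂ)) (cocompact ℂ) (𝓝 0) := by
    intro h hh
    induction hh using Submodule.span_induction with
    | mem v hv =>
      obtain ⟨w, rfl⟩ := hv
      have h1 (z : ℂ) : ‖(inner ℂ (kernel hα w) (normalizedKernel hα z) : ℂ)‖
          = Real.exp (α / 2 * ‖w‖ ^ 2) * Real.exp (-(α / 2) * ‖z - w‖ ^ 2) := by
        rw [inner_kernel, toEntire_normalizedKernel, normalizedKernelFun, Complex.norm_exp,
          ← Real.exp_add]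
        congr 1
        simp only [Complex.sq_norm, Complex.normSq_apply, ← Complex.ofReal_pow]
        simp
        ring
      rw [tendsto_zero_iff_norm_tendsto_zero]
      simp only [h1]
      have h2 : Tendsto (fun z : ℂ => ‖z - w‖) (cocompact ℂ) atTop :=
        tendsto_norm_cocompact_atTop.comp
          (Homeomorph.subRight w).isClosedEmbedding.tendsto_cocompact
      have h3 := Real.tendsto_exp_atBot.comp
        (((tendsto_pow_atTop two_ne_zero).comp h2).const_mul_atTop_of_neg
          (by linarith : -(α / 2) < 0))
      simpa using h3.const_mul (Real.exp (α / 2 * ‖w‖ ^ 2))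
    | zero => simp
    | add x y _ _ hx hy => simpa [inner_add_left (E := space α)] using hx.add hy
    | smul a x _ hx => simpa [inner_smul_left (E := space α)] using hx.const_mul (conj a)
  rw [Metric.tendsto_nhds]
  intro ε hε
  obtain ⟨h, hgh, hh⟩ := Metric.dense_iff.1 (dense_kernelSpan hα) g (ε / 2) (half_pos hε)
  filter_upwards [Metric.tendsto_nhds.1 (hspan h hh) (ε / 2) (half_pos hε)] with z hz
  rw [dist_zero_right] at hz ⊢
  have h1 : (inner ℂ g (normalizedKernel hα z) : ℂ)
      = inner ℂ (g - h) (normalizedKernel hα z) + inner ℂ h (normalizedKernel hα z) := by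
    rw [inner_sub_left (E := space α), sub_add_cancel]
  have h2 : ‖(inner ℂ (g - h) (normalizedKernel hα z) : ℂ)‖ ≤ ‖g - h‖ := by
    have := norm_inner_le_norm (𝕜 := ℂ) (g - h) (normalizedKernel hα z)
    rwa [norm_normalizedKernel, mul_one] at this
  rw [Metric.mem_ball, dist_comm, dist_eq_norm] at hgh
  rw [h1]
  linarith [norm_add_le (inner ℂ (g - h) (normalizedKernel hα z) : ℂ)
    (inner ℂ h (normalizedKernel hα z))]

/-- Up to unimodular factors, `⟨T k_z, k_{z-u}⟩` is `⟨A z k_0, k_u⟩` with `A z = U_z* T U_z`, and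
the Berezin transform of `A z` at `v` is that of `T` at `z - v`. Any weak limit of `A z` as `z → ∞`
thus has zero Berezin transform, so its kernel matrix vanishes. -/
theorem tendsto_inner_normalizedKernel_sub {α : ℝ} (hα : 0 < α) (T : space α →L[ℂ] space α)
    (hT : Tendsto (fun z => (inner ℂ (normalizedKernel hα z) (T (normalizedKernel hα z)) : ℂ))
      (cocompact ℂ) (𝓝 0)) (u : ℂ) :
    Tendsto (fun z => (inner ℂ (normalizedKernel hα (z - u)) (T (normalizedKernel hα z)) : ℂ))
      (cocompact ℂ) (𝓝 0) := by
  have := completeSpace hα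
  let V (z : ℂ) : space α →L[ℂ] space α :=
    (⟨U hα z, norm_U hα z⟩ : space α →ₗᵢ[ℂ] space α).toContinuousLinearMap
  have hV (z : ℂ) : ‖V z‖ ≤ 1 := LinearIsometry.norm_toContinuousLinearMap_le _
  let A (z : ℂ) : space α →L[ℂ] space α := (V z).adjoint.comp (T.comp (V z))
  have hA (z : ℂ) : ‖A z‖ ≤ ‖T‖ := by
    have h1 : ‖(V z).adjoint‖ ≤ 1 := by
      rw [LinearIsometryEquiv.norm_map]
      exact hV z
    calc ‖A z‖ ≤ ‖(V z).adjoint‖ * (‖T‖ * ‖V z‖) :=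
          (ContinuousLinearMap.opNorm_comp_le _ _).trans (by
            gcongr
            exact ContinuousLinearMap.opNorm_comp_le _ _)
      _ ≤ 1 * (‖T‖ * 1) := by gcongr; exact hV z
      _ = ‖T‖ := by ring
  have hAn (z v w : ℂ) : ‖(inner ℂ (normalizedKernel hα v) (A z (normalizedKernel hα w)) : ℂ)‖
      = ‖(inner ℂ (normalizedKernel hα (z - v)) (T (normalizedKernel hα (z - w))) : ℂ)‖ := by
    simp only [A, ContinuousLinearMap.comp_apply, ContinuousLinearMap.adjoint_inner_right]
    obtain ⟨c, hc, hcv⟩ := U_normalizedKernel hα z v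
    obtain ⟨d, hd, hdw⟩ := U_normalizedKernel hα z w
    have h1 : V z (normalizedKernel hα v) = c • normalizedKernel hα (z - v) := hcv
    have h2 : V z (normalizedKernel hα w) = d • normalizedKernel hα (z - w) := hdw
    rw [h1, h2, map_smul, inner_smul_left (E := space α), inner_smul_right (E := space α)]
    simp [hc, hd]
  rw [tendsto_iff_ultrafilter]
  intro 𝒰 h𝒰
  obtain ⟨B, hB⟩ := exists_tendsto_inner_ultrafilter 𝒰 A hA
  have hdiag (v : ℂ) :
      (inner ℂ (normalizedKernel hα v) (B (normalizedKernel hα v)) : ℂ) = 0 := by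
    have h1 := (hB (normalizedKernel hα v) (normalizedKernel hα v)).norm
    simp only [hAn] at h1
    have h2 : Tendsto (fun z => z - v) (cocompact ℂ) (cocompact ℂ) :=
      (Homeomorph.subRight v).isClosedEmbedding.tendsto_cocompact
    have h3 := ((hT.comp h2).mono_left h𝒰).norm
    exact norm_eq_zero.1 (tendsto_nhds_unique h1 (by simpa using h3))
  have hzero : (inner ℂ (normalizedKernel hα u) (B (normalizedKernel hα 0)) : ℂ) = 0 := by
    have h1 := inner_kernel_eq_zero_of_diagonal (differentiable_kernel_conj hα) B (fun v => by
      rw [kernel_eq, map_smul, inner_smul_left (E := space α), inner_smul_right (E := space α),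
        hdiag, mul_zero, mul_zero]) 0 u
    rw [normalizedKernel_eq, normalizedKernel_eq, map_smul, inner_smul_left (E := space α),
      inner_smul_right (E := space α), h1, mul_zero, mul_zero]
  have h1 := (hB (normalizedKernel hα 0) (normalizedKernel hα u)).norm
  simp only [hAn, hzero, sub_zero, norm_zero] at h1
  exact tendsto_zero_iff_norm_tendsto_zero.2 h1

end Fock

end

/-! ### The equivalence. -/

theorem theoremC {α : ℝ} (hα : 0 < α) (S : Fock.space α →ₗ.[ℂ] Fock.space α)
    (hdom : Fock.kernelSpan hα ≤ S.domain)
    (hadj : Fock.kernelSpan hα ≤ S.adjointDomain)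
    (hanal : Differentiable ℂ fun z : ℂ =>
      S ⟨Fock.kernel hα (conj z), hdom (Fock.kernel_mem hα (conj z))⟩)
    (p C : ℝ) (hp : 2 < p) (hC : 0 < C)
    (hbound : ∀ z : ℂ,
      eLpNorm (Fock.conjugate hα S z ⟨Fock.one hα, Fock.one_mem_domain hα hdom z⟩ :
          Lp ℂ 2 (Fock.gaussianMeasure α))
        (ENNReal.ofReal p) (Fock.gaussianMeasure α) ≤ ENNReal.ofReal C) :
    Fock.IsCompactOn S ↔ Tendsto (Fock.berezin hα S hdom) (cocompact ℂ) (𝓝 0) := by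
  have := Fock.completeSpace hα
  constructor
  · rintro ⟨T, hT, hTS⟩
    have h := hT.tendsto_inner_zero (Fock.norm_normalizedKernel hα)
      (Fock.tendsto_inner_normalizedKernel hα)
    refine h.congr fun z => ?_
    rw [Fock.berezin, ← hTS]
  · intro hber
    have hpq : p.HolderConjugate p.conjExponent := .conjExponent (by linarith)
    -- This is where `p > 2` enters: it makes the decay rate `δ` positive.
    have hq2 : p.conjExponent < 2 := by
      rw [Real.conjExponent, div_lt_iff₀ (by linarith)]
      linarith
    have hδ : 0 < α / 2 - α * p.conjExponent / 4 := by nlinarith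
    have hbd := Fock.norm_inner_normalizedKernel_apply_le hα hdom hpq hC.le hbound
    have hM := Fock.exists_norm_apply_le hα hdom hadj hδ hbd
    have hdense : DenseRange S.domain.subtype := by
      simpa [DenseRange] using (Fock.dense_kernelSpan hα).mono hdom
    -- The domain is dense, since it contains the kernels, and `S` is bounded on all of it, so the
    -- continuous extension agrees with `S` on the whole domain and not only on the kernels.
    let T : Fock.space α →L[ℂ] Fock.space α := S.toFun.extendOfNorm S.domain.subtype
    have hTS (f : S.domain) : T f = S f := LinearMap.extendOfNorm_eq hdense hM f
    have hTk (z : ℂ) : T (Fock.normalizedKernel hα z)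
        = S ⟨Fock.normalizedKernel hα z, hdom (Fock.normalizedKernel_mem hα z)⟩ :=
      hTS ⟨Fock.normalizedKernel hα z, hdom (Fock.normalizedKernel_mem hα z)⟩
    refine ⟨T, (Fock.isCoherentFamily hα).isCompactOperator_of_tendsto T hδ
      (fun z w => (hTk z).symm ▸ hbd z w) ?_, hTS⟩
    refine Fock.tendsto_inner_normalizedKernel_sub hα T (hber.congr fun z => ?_)
    rw [hTk, Fock.berezin]
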